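/- Let $\mathbb H=\{z\in\mathbb C:\operatorname{Im} z>0\}$ and let $\mathfrak R$ be the class of univalent (that is, injective) analytic functions $f:\mathbb H\to\mathbb H$ for which there is a constant $C\in[0,\infty)$ with $$|f(z)-z|\le \frac{C}{\operatorname{Im} z}\qquad\text{for all } z\in\mathbb H .$$ For $f,g\in\mathfrak R$ write $f\prec g$ if $f=g\circ h$ for some $h\in\mathfrak R$. Let $f,g\in\mathfrak R$. Then $f\prec g$ if and only if $f(\mathbb H)\subseteq g(\mathbb H)$. Moreover, let $a$ and $b$ be the least constants $C\in[0,\infty)$ in the above inequality for $f$ and for $g$, respectively. These least constants exist, and $$a=\lim_{y\to\infty} iy\,[iy-f(iy)],\qquad b=\lim_{y\to\infty} iy\,[iy-g(iy)].$$ If $f\prec g$, then $a\ge b$, with equality if and only if $f\equiv g$. -/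

import Mathlib

open Filter Topology
open scoped Manifold

namespace ChordalLoewner

/-- The constants `C ∈ [0, ∞)` with `|f(z) - z| ≤ C / Im z` for all `z` in the upper half-plane. -/
def boundConstants (f : UpperHalfPlane → UpperHalfPlane) : Set ℝ :=
  {C : ℝ | 0 ≤ C ∧ ∀ z : UpperHalfPlane, ‖(f z : ℂ) - (z : ℂ)‖ ≤ C / z.im}

/-- The class of univalent analytic self-maps `f` of the upper half-plane such that
`|f(z) - z| ≤ C / Im z` on the upper half-plane, for some constant `C ∈ [0, ∞)`. -/
structure IsClassR (f : UpperHalfPlane → UpperHalfPlane) : Prop where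
  /-- `f` is analytic. -/
  analytic : MDifferentiable 𝓘(ℂ) 𝓘(ℂ) (fun z : UpperHalfPlane => (f z : ℂ))
  /-- `f` is univalent. -/
  univalent : Function.Injective f
  /-- `f` satisfies the bound for some constant. -/
  bound : (boundConstants f).Nonempty

/-- `f ≺ g`: `f = g ∘ h` for some `h` in the class. -/
def Subordinate (f g : UpperHalfPlane → UpperHalfPlane) : Prop :=
  ∃ h : UpperHalfPlane → UpperHalfPlane, IsClassR h ∧ f = g ∘ h

/-- The function `y ↦ iy [iy - f(iy)]`. Only its values for `y > 0` are meaningful; for these,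
`UpperHalfPlane.ofComplex (iy)` is the point `iy` of the upper half-plane. -/
noncomputable def axisFunction (f : UpperHalfPlane → UpperHalfPlane) (y : ℝ) : ℂ :=
  Complex.I * y * (Complex.I * y - (f (UpperHalfPlane.ofComplex (Complex.I * y)) : ℂ))

end ChordalLoewner

namespace ChordalLoewner

open UpperHalfPlane (upperHalfPlaneSet isOpen_upperHalfPlaneSet ofComplex)
open ComplexConjugate

/-! Put `p = f - id`. The bound at `∞` and Phragmén–Lindelöf give `Im p ≥ 0`, so unless `p` vanishes
identically `-1/p` maps into the closed half-plane. Julia–Carathéodory at `∞` gives it an angular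
derivative `α > 0`, and `α * Im z ≤ Im (-1/p) ≤ 1/|p|` makes `1/α` a bound constant that is also the
limit along the axis. Any other bound constant dominates that limit (`exists_bound_and_tendsto`). If
the ranges are nested, take `h = g⁻¹ ∘ f`. It stays within bounded distance of the identity high on
the axis, so its angular derivative is `1` and `Im h ≥ Im z`. The bounds of `f` and `g` then give
one for `h` (`of_eq_comp`). Limits add under composition, so `a = b + c` with `c ≥ 0`, and `c = 0`
forces `h = id`. -/

/-! ### Schwarz–Pick in the half-plane -/

lemma normSq_sub_conj (u v : ℂ) :
    ‖u - conj v‖ ^ 2 = ‖u - v‖ ^ 2 + 4 * u.im * v.im := by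
  simp only [← Complex.normSq_eq_norm_sq, Complex.normSq_apply, Complex.sub_re, Complex.sub_im,
    Complex.conj_re, Complex.conj_im]
  ring

lemma sub_conj_ne_zero {u v : ℂ} (hu : 0 < u.im) (hv : 0 < v.im) : u - conj v ≠ 0 := by
  intro h
  have := congrArg Complex.im h
  simp at this
  linarith

lemma norm_sub_div_sub_conj_lt_one {u v : ℂ} (hu : 0 < u.im) (hv : 0 < v.im) :
    ‖(u - v) / (u - conj v)‖ < 1 := by
  have h0 := norm_pos_iff.2 (sub_conj_ne_zero hu hv)
  rw [norm_div, div_lt_one h0]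
  have := normSq_sub_conj u v
  have h4 : 0 < 4 * u.im * v.im := by positivity
  exact lt_of_pow_lt_pow_left₀ 2 h0.le (by linarith)

/-- The Cayley transform of the unit disc onto the upper half-plane that sends `0` to `w`. -/
lemma im_cayley_pos {w ζ : ℂ} (hw : 0 < w.im) (hζ : ‖ζ‖ < 1) :
    0 < ((w - conj w * ζ) / (1 - ζ)).im := by
  have h1 : 1 - ζ ≠ 0 := by
    rintro h
    rw [← sub_eq_zero.1 h] at hζ
    simp at hζ
  have h2 := Complex.normSq_pos.2 h1
  have h3 : ζ.re * ζ.re + ζ.im * ζ.im < 1 := by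
    rw [← Complex.normSq_apply, Complex.normSq_eq_norm_sq]
    exact pow_lt_one₀ (norm_nonneg _) hζ two_ne_zero
  have : ((w - conj w * ζ) / (1 - ζ)).im
      = w.im * (1 - (ζ.re * ζ.re + ζ.im * ζ.im)) / Complex.normSq (1 - ζ) := by
    rw [Complex.div_im]
    simp
    field_simp
    ring
  rw [this]
  have : 0 < 1 - (ζ.re * ζ.re + ζ.im * ζ.im) := by linarith
  positivity

/-- The **Schwarz–Pick inequality** for self-maps of the upper half-plane. -/
theorem schwarzPick_of_im_pos {F : ℂ → ℂ} (hF : DifferentiableOn ℂ F upperHalfPlaneSet)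
    (hpos : ∀ z : ℂ, 0 < z.im → 0 < (F z).im) {z w : ℂ} (hz : 0 < z.im) (hw : 0 < w.im) :
    ‖F z - F w‖ ^ 2 * (z.im * w.im) ≤ ‖z - w‖ ^ 2 * ((F z).im * (F w).im) := by
  set φ : ℂ → ℂ := fun ζ => (w - conj w * ζ) / (1 - ζ) with hφ
  set ψ : ℂ → ℂ := fun u => (u - F w) / (u - conj (F w)) with hψ
  have hφm : ∀ ζ ∈ Metric.ball (0 : ℂ) 1, 0 < (φ ζ).im := fun ζ hζ =>
    im_cayley_pos hw (by simpa using hζ)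
  have hφd : DifferentiableOn ℂ φ (Metric.ball 0 1) := by
    refine DifferentiableOn.div (by fun_prop) (by fun_prop) fun ζ hζ h => ?_
    rw [← sub_eq_zero.1 h] at hζ
    simp at hζ
  have hψd : DifferentiableOn ℂ ψ upperHalfPlaneSet :=
    DifferentiableOn.div (by fun_prop) (by fun_prop) fun u hu => sub_conj_ne_zero hu (hpos w hw)
  have hd : DifferentiableOn ℂ (ψ ∘ F ∘ φ) (Metric.ball 0 1) :=
    hψd.comp (hF.comp hφd hφm) fun ζ hζ => hpos _ (hφm ζ hζ)
  have hm : Set.MapsTo (ψ ∘ F ∘ φ) (Metric.ball 0 1) (Metric.closedBall 0 1) := fun ζ hζ => by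
    exact mem_closedBall_zero_iff.2
      (norm_sub_div_sub_conj_lt_one (hpos _ (hφm ζ hζ)) (hpos w hw)).le
  have h0 : (ψ ∘ F ∘ φ) 0 = 0 := by simp [hφ, hψ]
  have hzw := sub_conj_ne_zero hz hw
  have hww := sub_conj_ne_zero hw hw
  have hζ := norm_sub_div_sub_conj_lt_one hz hw
  have key := Complex.norm_le_norm_of_mapsTo_ball hd hm h0 hζ
  have hφz : φ ((z - w) / (z - conj w)) = z := by
    have e : 1 - (z - w) / (z - conj w) = (w - conj w) / (z - conj w) := by
      field_simp; ring
    simp only [hφ, e]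
    rw [div_eq_iff (div_ne_zero hww hzw)]
    field_simp
    ring
  simp only [Function.comp_apply, hφz, hψ] at key
  have hFzw := sub_conj_ne_zero (hpos z hz) (hpos w hw)
  rw [norm_div, norm_div, div_le_div_iff₀ (norm_pos_iff.2 hFzw) (norm_pos_iff.2 hzw)] at key
  have key2 := pow_le_pow_left₀ (by positivity) key 2
  rw [mul_pow, mul_pow, normSq_sub_conj, normSq_sub_conj] at key2
  linarith

/-- The Schwarz–Pick inequality for maps into the closed upper half-plane. -/
theorem schwarzPick {F : ℂ → ℂ} (hF : DifferentiableOn ℂ F upperHalfPlaneSet)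
    (hpos : ∀ z : ℂ, 0 < z.im → 0 ≤ (F z).im) {z w : ℂ} (hz : 0 < z.im) (hw : 0 < w.im) :
    ‖F z - F w‖ ^ 2 * (z.im * w.im) ≤ ‖z - w‖ ^ 2 * ((F z).im * (F w).im) := by
  -- Translate by `I * δ` into the open half-plane, then let `δ → 0`.
  have h : ∀ δ : ℝ, 0 < δ → ‖F z - F w‖ ^ 2 * (z.im * w.im)
      ≤ ‖z - w‖ ^ 2 * (((F z).im + δ) * ((F w).im + δ)) := fun δ hδ => by
    have := schwarzPick_of_im_pos (F := fun z => F z + Complex.I * δ) (by fun_prop)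
      (fun z hz => by simpa using add_pos_of_nonneg_of_pos (hpos z hz) hδ) hz hw
    simpa using this
  refine ge_of_tendsto (f := fun δ : ℝ => ‖z - w‖ ^ 2 * (((F z).im + δ) * ((F w).im + δ)))
    (x := 𝓝[>] (0 : ℝ)) ?_ (eventually_nhdsWithin_of_forall h)
  refine (Continuous.tendsto' (by fun_prop) _ _ ?_).mono_left nhdsWithin_le_nhds
  simp

/-! ### Angular derivative at infinity -/

/-- Schwarz–Pick between `iy` and `w` gives `(R - εy)² ≤ 4εyR` for `R = ‖F(iy)‖ > 8εy` and large
`y`, which is impossible. -/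
lemma eventually_norm_div_le_of_im_le {F : ℂ → ℂ} (hF : DifferentiableOn ℂ F upperHalfPlaneSet)
    (hpos : ∀ z : ℂ, 0 < z.im → 0 ≤ (F z).im) {w : ℂ} (hw : 0 < w.im) {ε : ℝ} (hε : 0 < ε)
    (hle : (F w).im ≤ ε * w.im) :
    ∀ᶠ y : ℝ in atTop, ‖F (Complex.I * y) / (Complex.I * y)‖ ≤ 8 * ε := by
  have h1 : Tendsto (fun y : ℝ => ‖F w‖ / y) atTop (𝓝 0) := tendsto_const_nhds.div_atTop tendsto_id
  have h2 : Tendsto (fun y : ℝ => ‖w‖ / y) atTop (𝓝 0) := tendsto_const_nhds.div_atTop tendsto_id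
  filter_upwards [eventually_gt_atTop 0, h1.eventually_le_const hε,
    h2.eventually_le_const one_pos] with y hy h1 h2
  have hIy : 0 < (Complex.I * (y : ℂ)).im := by simpa using hy
  have hIyn : ‖Complex.I * (y : ℂ)‖ = y := by simp [abs_of_pos hy]
  rw [div_le_iff₀ hy] at h1 h2
  have key := schwarzPick hF hpos hIy hw
  set R := ‖F (Complex.I * y)‖ with hR
  have hd : ‖Complex.I * y - w‖ ≤ 2 * y := (norm_sub_le _ _).trans (by rw [hIyn]; linarith)
  have hre : R - ‖F w‖ ≤ ‖F (Complex.I * y) - F w‖ := norm_sub_norm_le _ _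
  have him : (F (Complex.I * y)).im ≤ R := (le_abs_self _).trans (Complex.abs_im_le_norm _)
  rw [norm_div, hIyn, div_le_iff₀ hy]
  have hyi : (Complex.I * (y : ℂ)).im = y := by simp
  rw [hyi] at key
  have hR0 : 0 ≤ R := norm_nonneg _
  have k2 : ‖Complex.I * y - w‖ ^ 2 * ((F (Complex.I * y)).im * (F w).im)
      ≤ (2 * y) ^ 2 * (R * (ε * w.im)) := by
    have := hpos _ hw
    have := hpos _ hIy
    gcongr
  have k3 : ‖F (Complex.I * y) - F w‖ ^ 2 ≤ 4 * y * ε * R := by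
    have : ‖F (Complex.I * y) - F w‖ ^ 2 * (y * w.im) ≤ (4 * y * ε * R) * (y * w.im) := by
      linarith
    exact le_of_mul_le_mul_right this (by positivity)
  by_contra! hcon
  have hA : 0 < ε * y := by positivity
  have k4 : (R - ε * y) ^ 2 ≤ ‖F (Complex.I * y) - F w‖ ^ 2 :=
    pow_le_pow_left₀ (by linarith) (by linarith) 2
  nlinarith

/-- The **Julia–Carathéodory lemma** at the boundary point `∞` of the upper half-plane. -/
theorem exists_angularDeriv {F : ℂ → ℂ} (hF : DifferentiableOn ℂ F upperHalfPlaneSet)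
    (hpos : ∀ z : ℂ, 0 < z.im → 0 ≤ (F z).im) :
    ∃ α : ℝ, 0 ≤ α ∧ (∀ z : ℂ, 0 < z.im → α * z.im ≤ (F z).im) ∧
      Tendsto (fun y : ℝ => F (Complex.I * y) / (Complex.I * y)) atTop (𝓝 (α : ℂ)) := by
  set S : Set ℝ := (fun z : ℂ => (F z).im / z.im) '' upperHalfPlaneSet with hS
  have hne : S.Nonempty := ⟨_, Complex.I, by simp, rfl⟩
  have hS0 : ∀ s ∈ S, 0 ≤ s := by
    rintro _ ⟨z, hz, rfl⟩
    exact div_nonneg (hpos z hz) (le_of_lt hz)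
  have hbdd : BddBelow S := ⟨0, hS0⟩
  have hle : ∀ z : ℂ, 0 < z.im → sInf S * z.im ≤ (F z).im := fun z hz => by
    rw [← le_div_iff₀ hz]
    exact csInf_le hbdd ⟨z, hz, rfl⟩
  refine ⟨sInf S, le_csInf hne hS0, hle, ?_⟩
  -- Removing the linear part leaves a map whose ratio `Im G / Im z` has infimum `0`.
  set G : ℂ → ℂ := fun z => F z - sInf S * z with hG
  have hGd : DifferentiableOn ℂ G upperHalfPlaneSet := by fun_prop
  have hGp : ∀ z : ℂ, 0 < z.im → 0 ≤ (G z).im := fun z hz => by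
    simpa [hG] using hle z hz
  rw [tendsto_iff_norm_sub_tendsto_zero]
  rw [tendsto_order]
  refine ⟨fun a ha => Eventually.of_forall fun y => ha.trans_le (norm_nonneg _), fun a ha => ?_⟩
  obtain ⟨_, ⟨w, hw, rfl⟩, hlt⟩ := exists_lt_of_csInf_lt hne
    (show sInf S < sInf S + a / 16 by linarith)
  have hw' : 0 < w.im := hw
  have := eventually_norm_div_le_of_im_le hGd hGp hw (show 0 < a / 16 by linarith) (by
    have := (div_lt_iff₀ hw').1 hlt
    simp [hG]
    linarith)
  filter_upwards [this, eventually_gt_atTop 0] with y hy hy0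
  have hne : Complex.I * (y : ℂ) ≠ 0 := by simp [hy0.ne']
  rw [hG] at hy
  simp only [sub_div, mul_div_cancel_right₀ _ hne] at hy
  linarith

/-! ### Growth of the imaginary part -/

/-- Phragmén–Lindelöf for `exp (I * p)`, whose modulus is `exp (-Im p)`, after rotating `Im z > ε`
onto the right half-plane. -/
lemma neg_le_im_of_le_on_line {p : ℂ → ℂ} (hp : DifferentiableOn ℂ p upperHalfPlaneSet) {ε B : ℝ}
    (hε : 0 < ε) (hB : ∀ z : ℂ, ε ≤ z.im → ‖p z‖ ≤ B) (hline : ∀ z : ℂ, z.im = ε → -ε ≤ (p z).im)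
    {z : ℂ} (hz : ε ≤ z.im) : -ε ≤ (p z).im := by
  set φ : ℂ → ℂ := fun ζ => Complex.exp (Complex.I * p (Complex.I * (ζ + ε))) with hφ
  have hφn : ∀ ζ, ‖φ ζ‖ = Real.exp (-(p (Complex.I * (ζ + ε))).im) := fun ζ => by
    simp [hφ, Complex.norm_exp]
  have him : ∀ ζ : ℂ, (Complex.I * (ζ + ε)).im = ζ.re + ε := fun ζ => by simp
  have hbound : ∀ ζ : ℂ, 0 ≤ ζ.re → ‖φ ζ‖ ≤ Real.exp B := fun ζ hζ => by
    rw [hφn, Real.exp_le_exp]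
    have := hB (Complex.I * (ζ + ε)) (by rw [him]; linarith)
    linarith [neg_abs_le (p (Complex.I * (ζ + ε))).im,
      Complex.abs_im_le_norm (p (Complex.I * (ζ + ε)))]
  have hcl : closure {ζ : ℂ | 0 < ζ.re} ⊆ {ζ : ℂ | 0 ≤ ζ.re} :=
    closure_minimal (fun ζ (hζ : 0 < ζ.re) => hζ.le)
      (isClosed_le continuous_const Complex.continuous_re)
  have hd : DiffContOnCl ℂ φ {ζ : ℂ | 0 < ζ.re} := by
    apply DifferentiableOn.diffContOnCl
    have : DifferentiableOn ℂ (fun ζ : ℂ => p (Complex.I * (ζ + ε))) {ζ : ℂ | 0 ≤ ζ.re} :=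
      hp.comp (f := fun ζ : ℂ => Complex.I * (ζ + ε)) (by fun_prop)
        fun ζ (hζ : 0 ≤ ζ.re) => show 0 < (Complex.I * (ζ + ε)).im by rw [him]; linarith
    exact (this.const_mul Complex.I).cexp.mono hcl
  have key := PhragmenLindelof.right_half_plane_of_bounded_on_real (C := Real.exp ε) hd
    ⟨1, by norm_num, 0, by
      refine Asymptotics.IsBigO.of_bound (Real.exp B) ?_
      refine eventually_inf_principal.2 (Eventually.of_forall fun ζ (hζ : 0 < ζ.re) => ?_)
      simpa using hbound ζ hζ.le⟩
    (isBoundedUnder_of_eventually_le (a := Real.exp B) (by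
      filter_upwards [eventually_ge_atTop 0] with x hx using hbound x (by simpa using hx)))
    (fun x => by
      rw [hφn, Real.exp_le_exp]
      linarith [hline (Complex.I * (x * Complex.I + ε)) (by simp)])
    (z := -Complex.I * z - ε) (by simpa using hz)
  rw [hφn, Real.exp_le_exp] at key
  have e : Complex.I * (-Complex.I * z - ε + ε) = z := by
    linear_combination (-z) * Complex.I_sq
  rw [e] at key
  linarith

/-- A self-map of the upper half-plane that is close to the identity near `∞`
does not decrease the imaginary part. -/
theorem im_le_im_of_norm_sub_le {F : ℂ → ℂ} (hF : DifferentiableOn ℂ F upperHalfPlaneSet)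
    (hpos : ∀ z : ℂ, 0 < z.im → 0 ≤ (F z).im) {C : ℝ} (hC : 0 ≤ C)
    (hb : ∀ z : ℂ, 0 < z.im → ‖F z - z‖ ≤ C / z.im) {z : ℂ} (hz : 0 < z.im) :
    z.im ≤ (F z).im := by
  have h : ∀ ε : ℝ, 0 < ε → ε ≤ z.im → -ε ≤ (F z - z).im := fun ε hε hle => by
    refine neg_le_im_of_le_on_line (p := fun z => F z - z) (B := C / ε) (by fun_prop) hε
      (fun w hw => (hb w (hε.trans_le hw)).trans ?_) (fun w hw => ?_) hle
    · gcongr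
    · simp only [Complex.sub_im, hw]
      linarith [hpos w (hw ▸ hε)]
  by_contra! hcon
  have := h (min z.im ((z.im - (F z).im) / 2)) (lt_min hz (by linarith)) (min_le_left _ _)
  simp only [Complex.sub_im] at this
  linarith [min_le_right z.im ((z.im - (F z).im) / 2)]

/-! ### The least constant as a limit -/

/-- The Nevanlinna-type asymptotics at `∞` of a function with nonnegative imaginary part
that is `O(1 / Im z)`. -/
theorem exists_bound_and_tendsto {p : ℂ → ℂ} (hp : DifferentiableOn ℂ p upperHalfPlaneSet)
    (hpos : ∀ z : ℂ, 0 < z.im → 0 ≤ (p z).im) {C : ℝ}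
    (hb : ∀ z : ℂ, 0 < z.im → ‖p z‖ ≤ C / z.im) :
    ∃ c : ℝ, 0 ≤ c ∧ (∀ z : ℂ, 0 < z.im → ‖p z‖ ≤ c / z.im) ∧
      Tendsto (fun y : ℝ => -(Complex.I * y * p (Complex.I * y))) atTop (𝓝 (c : ℂ)) := by
  -- A single zero forces `p = 0` by Schwarz–Pick; otherwise `-1/p` is available.
  by_cases h0 : ∃ w : ℂ, 0 < w.im ∧ p w = 0
  · obtain ⟨w, hw, hpw⟩ := h0
    have hz0 : ∀ z : ℂ, 0 < z.im → p z = 0 := fun z hz => by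
      have := schwarzPick hp hpos hz hw
      simp only [hpw, sub_zero, Complex.zero_im, mul_zero] at this
      have h2 : 0 < z.im * w.im := by positivity
      have h3 : ‖p z‖ ^ 2 ≤ 0 := nonpos_of_mul_nonpos_left this h2
      simpa using le_antisymm h3 (by positivity)
    refine ⟨0, le_rfl, fun z hz => by simp [hz0 z hz], ?_⟩
    refine tendsto_const_nhds.congr' ?_
    filter_upwards [eventually_gt_atTop 0] with y hy
    rw [hz0 _ (by simpa using hy)]
    simp
  push Not at h0
  have hI : ∀ y : ℝ, 0 < y → 0 < (Complex.I * (y : ℂ)).im := fun y hy => by simpa using hy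
  obtain ⟨α, hα0, hα, hlim⟩ := exists_angularDeriv (F := fun z => -(p z)⁻¹)
    (hp.inv h0).neg (fun z hz => by
      simp only [Complex.neg_im, Complex.inv_im]
      have := hpos z hz
      rw [neg_div, neg_neg]
      exact div_nonneg this (Complex.normSq_nonneg _))
  have hlim2 : Tendsto (fun y : ℝ => ‖-(p (Complex.I * y))⁻¹ / (Complex.I * y)‖) atTop (𝓝 α) := by
    simpa [abs_of_nonneg hα0] using hlim.norm
  have hmain : ∀ y : ℝ, 0 < y → (Complex.I * y) * p (Complex.I * y) ≠ 0 := fun y hy =>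
    mul_ne_zero (by simp [hy.ne']) (h0 _ (hI y hy))
  have hCpos : 0 < C := by
    have := (norm_pos_iff.2 (h0 Complex.I (by simp))).trans_le (hb Complex.I (by simp))
    simpa using this
  have hαpos : 0 < α := by
    refine (inv_pos.2 hCpos).trans_le (ge_of_tendsto hlim2 ?_)
    filter_upwards [eventually_gt_atTop 0] with y hy
    have h1 := hb _ (hI y hy)
    have h2 : (Complex.I * (y : ℂ)).im = y := by simp
    rw [h2, le_div_iff₀ hy] at h1
    have h3 := norm_pos_iff.2 (h0 _ (hI y hy))
    rw [norm_div, norm_neg, norm_inv, norm_mul, Complex.norm_I, Complex.norm_real, one_mul,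
      Real.norm_of_nonneg hy.le, div_eq_mul_inv, ← mul_inv]
    exact inv_anti₀ (by positivity) h1
  refine ⟨α⁻¹, inv_nonneg.2 hα0, fun z hz => ?_, ?_⟩
  · have h1 := hα z hz
    have h2 : (-(p z)⁻¹).im ≤ ‖p z‖⁻¹ := by
      rw [← norm_inv, ← norm_neg]
      exact (le_abs_self _).trans (Complex.abs_im_le_norm _)
    have h3 := norm_pos_iff.2 (h0 z hz)
    rw [inv_eq_one_div, div_div, ← one_div_one_div ‖p z‖]
    apply one_div_le_one_div_of_le (by positivity)
    rw [one_div]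
    linarith
  · rw [Complex.ofReal_inv]
    refine (hlim.inv₀ (by simpa using hαpos.ne')).congr' ?_
    filter_upwards [eventually_gt_atTop 0] with y hy
    have h1 := h0 _ (hI y hy)
    simp only [div_eq_mul_inv, mul_inv, inv_neg, inv_inv]
    ring

/-! ### Perturbations of the identity and inverses -/

theorem norm_sub_le_of_norm_le {p : ℂ → ℂ} (hp : DifferentiableOn ℂ p upperHalfPlaneSet)
    (hpos : ∀ z : ℂ, 0 < z.im → 0 ≤ (p z).im) {C : ℝ} (hC : 0 ≤ C)
    (hb : ∀ z : ℂ, 0 < z.im → ‖p z‖ ≤ C / z.im) {z w : ℂ} (hz : 0 < z.im) (hw : 0 < w.im) :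
    ‖p z - p w‖ ≤ C / (z.im * w.im) * ‖z - w‖ := by
  have key := schwarzPick hp hpos hz hw
  have him : ∀ z : ℂ, 0 < z.im → (p z).im ≤ C / z.im := fun z hz =>
    ((le_abs_self _).trans (Complex.abs_im_le_norm _)).trans (hb z hz)
  have h1 : ‖z - w‖ ^ 2 * ((p z).im * (p w).im) ≤ ‖z - w‖ ^ 2 * (C / z.im * (C / w.im)) := by
    have := hpos z hz
    have := hpos w hw
    have := him z hz
    have := him w hw
    gcongr
  refine le_of_sq_le_sq ?_ (by positivity)
  have h2 : 0 < z.im * w.im := by positivity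
  refine le_of_mul_le_mul_right ((key.trans h1).trans_eq ?_) h2
  field_simp

/-- A perturbation `w ↦ w + p w` of the identity attains every value `ζ` that is high enough in
the upper half-plane. -/
theorem exists_add_eq {p : ℂ → ℂ} (hp : DifferentiableOn ℂ p upperHalfPlaneSet)
    (hpos : ∀ z : ℂ, 0 < z.im → 0 ≤ (p z).im) {C : ℝ} (hC : 0 ≤ C)
    (hb : ∀ z : ℂ, 0 < z.im → ‖p z‖ ≤ C / z.im) {ζ : ℂ} (hζ : C + 2 ≤ ζ.im) :
    ∃ w : ℂ, C + 1 ≤ w.im ∧ w + p w = ζ := by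
  -- On `s`, `‖p‖ ≤ 1` and `p` has Lipschitz constant `C / (C + 1)² < 1`, so `w ↦ ζ - p w` is a
  -- contraction of `s`.
  set s : Set ℂ := {w : ℂ | C + 1 ≤ w.im} with hs
  have hsc : IsComplete s := (isClosed_le continuous_const Complex.continuous_im).isComplete
  have hs0 : ∀ w ∈ s, 0 < w.im := fun w (hw : C + 1 ≤ w.im) => by linarith
  have hmaps : Set.MapsTo (fun w => ζ - p w) s s := fun w hw => by
    have h1 := hb w (hs0 w hw)
    have h2 : C / w.im ≤ 1 := (div_le_one (hs0 w hw)).2 (by have : C + 1 ≤ w.im := hw; linarith)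
    have h3 : (p w).im ≤ ‖p w‖ := (le_abs_self _).trans (Complex.abs_im_le_norm _)
    simp only [hs, Set.mem_ofPred_eq, Complex.sub_im]
    linarith
  have hk : C / ((C + 1) * (C + 1)) < 1 := by
    rw [div_lt_one (by positivity)]
    nlinarith
  have hlip : ContractingWith (Real.toNNReal (C / ((C + 1) * (C + 1)))) (hmaps.restrict _ s s) := by
    refine ⟨by simpa using hk, LipschitzWith.of_dist_le_mul fun x y => ?_⟩
    rw [Real.coe_toNNReal _ (by positivity), Subtype.dist_eq, Subtype.dist_eq, dist_eq_norm,
      dist_eq_norm]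
    simp only [Set.MapsTo.val_restrict_apply, sub_sub_sub_cancel_left]
    rw [norm_sub_rev]
    have hx : C + 1 ≤ (x : ℂ).im := x.2
    have hy : C + 1 ≤ (y : ℂ).im := y.2
    refine (norm_sub_le_of_norm_le hp hpos hC hb (hs0 _ x.2) (hs0 _ y.2)).trans ?_
    have := hs0 _ x.2
    gcongr
  obtain ⟨w, hw, hfix, -⟩ := hlip.exists_fixedPoint' hsc hmaps
    (show ζ ∈ s by simp only [hs, Set.mem_ofPred_eq]; linarith) (edist_ne_top _ _)
  refine ⟨w, hw, ?_⟩
  have : ζ - p w = w := hfix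
  linear_combination -this

/-- The inverse of an injective holomorphic function is holomorphic. -/
theorem differentiableOn_invFunOn {G : ℂ → ℂ} {U : Set ℂ} (hU : IsOpen U)
    (hG : DifferentiableOn ℂ G U) (hinj : Set.InjOn G U) :
    DifferentiableOn ℂ (Function.invFunOn G U) (G '' U) := by
  set k := Function.invFunOn G U with hk
  have hleft : ∀ w ∈ U, k (G w) = w := fun w hw => hinj.leftInvOn_invFunOn hw
  have han : ∀ w ∈ U, AnalyticAt ℂ G w := fun w hw => hG.analyticAt (hU.mem_nhds hw)
  have hnc : ∀ w ∈ U, ¬ ∀ᶠ z in 𝓝 w, G z = G w := fun w hw h => by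
    have h2 : ∀ᶠ z in 𝓝[≠] w, z = w := by
      filter_upwards [nhdsWithin_le_nhds h, nhdsWithin_le_nhds (hU.mem_nhds hw)] with z hz hzU
      exact hinj hzU hw hz
    obtain ⟨z, hz1, hz2⟩ := (h2.and eventually_mem_nhdsWithin).exists
    exact hz2 hz1
  have hnhds : ∀ w ∈ U, 𝓝 (G w) ≤ map G (𝓝 w) := fun w hw =>
    (han w hw).eventually_constant_or_nhds_le_map_nhds.resolve_left (hnc w hw)
  have hev : ∀ w ∈ U, ∀ᶠ u in 𝓝 (G w), u ∈ G '' U := fun w hw =>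
    hnhds w hw (mem_map.2 (by
      filter_upwards [hU.mem_nhds hw] with z hz using Set.mem_image_of_mem G hz))
  have hcont : ∀ w ∈ U, ContinuousAt k (G w) := fun w hw => by
    unfold ContinuousAt
    rw [hleft w hw]
    refine (tendsto_map'_iff.2 ?_).mono_left (hnhds w hw)
    refine tendsto_id.congr' ?_
    filter_upwards [hU.mem_nhds hw] with z hz using (hleft z hz).symm
  have hdiff : ∀ w ∈ U, deriv G w ≠ 0 → DifferentiableAt ℂ k (G w) := fun w hw hne => by
    refine (HasDerivAt.of_local_left_inverse (f := G) (f' := deriv G w) (hcont w hw) ?_ hne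
      ?_).differentiableAt
    · rw [hleft w hw]
      exact (han w hw).differentiableAt.hasDerivAt
    · filter_upwards [hev w hw]
      rintro _ ⟨z, hz, rfl⟩
      rw [hleft z hz]
  rintro _ ⟨w, hw, rfl⟩
  refine DifferentiableAt.differentiableWithinAt ?_
  -- Critical points of `G` are isolated, so for the continuous inverse they are removable
  -- singularities; `deriv G ≠ 0` at `w` itself need not be shown.
  refine (Complex.analyticAt_of_differentiable_on_punctured_nhds_of_continuousAt ?_
    (hcont w hw)).differentiableAt
  have hd : ∀ᶠ z in 𝓝[≠] w, deriv G z ≠ 0 := by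
    refine (han w hw).deriv.eventually_eq_zero_or_eventually_ne_zero.resolve_left fun h0 => ?_
    apply hnc w hw
    obtain ⟨r, hr, hball⟩ := Metric.eventually_nhds_iff_ball.1 (h0.and (hU.mem_nhds hw))
    filter_upwards [Metric.ball_mem_nhds w hr] with z hz
    exact Metric.isOpen_ball.is_const_of_deriv_eq_zero (convex_ball w r).isPreconnected
      (hG.mono fun x hx => (hball x hx).2) (fun x hx => (hball x hx).1) hz
      (Metric.mem_ball_self hr)
  have hk_tendsto : Tendsto k (𝓝[≠] (G w)) (𝓝[≠] w) := by
    refine tendsto_nhdsWithin_iff.2 ⟨?_, ?_⟩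
    · have := (hcont w hw).tendsto
      rw [hleft w hw] at this
      exact this.mono_left nhdsWithin_le_nhds
    · filter_upwards [nhdsWithin_le_nhds (hev w hw), self_mem_nhdsWithin]
      rintro _ ⟨z, hz, rfl⟩ hne
      rw [hleft z hz]
      rintro rfl
      exact hne rfl
  filter_upwards [hk_tendsto.eventually hd, nhdsWithin_le_nhds (hev w hw)]
  rintro _ hne ⟨z, hz, rfl⟩
  rw [hleft z hz] at hne
  exact hdiff z hz hne

/-! ### The class and its composition structure -/

/-- The extension to `ℂ` of a self-map of the upper half-plane, with values in `ℂ`. -/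
noncomputable def lift (f : UpperHalfPlane → UpperHalfPlane) (z : ℂ) : ℂ := f (ofComplex z)

@[simp]
lemma lift_coe (f : UpperHalfPlane → UpperHalfPlane) (z : UpperHalfPlane) :
    lift f (z : ℂ) = f z := by
  simp [lift]

lemma im_lift_pos (f : UpperHalfPlane → UpperHalfPlane) (z : ℂ) : 0 < (lift f z).im :=
  (f (ofComplex z)).im_pos

lemma lift_comp (g h : UpperHalfPlane → UpperHalfPlane) (z : ℂ) :
    lift (g ∘ h) z = lift g (lift h z) := by
  simp [lift]

lemma mem_boundConstants_iff {f : UpperHalfPlane → UpperHalfPlane} {C : ℝ} :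
    C ∈ boundConstants f ↔ 0 ≤ C ∧ ∀ z : ℂ, 0 < z.im → ‖lift f z - z‖ ≤ C / z.im :=
  and_congr_right fun _ =>
    ⟨fun h z hz => by simpa using lift_coe f ⟨z, hz⟩ ▸ h ⟨z, hz⟩,
      fun h z => by simpa using h z z.im_pos⟩

lemma mdifferentiable_iff_lift {f : UpperHalfPlane → UpperHalfPlane} :
    MDifferentiable 𝓘(ℂ) 𝓘(ℂ) (fun z : UpperHalfPlane => (f z : ℂ)) ↔
      DifferentiableOn ℂ (lift f) upperHalfPlaneSet :=
  UpperHalfPlane.mdifferentiable_iff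

lemma axisFunction_eq (f : UpperHalfPlane → UpperHalfPlane) (y : ℝ) :
    axisFunction f y = -(Complex.I * y * (lift f (Complex.I * y) - Complex.I * y)) := by
  simp only [axisFunction, lift]
  ring

lemma injOn_lift {f : UpperHalfPlane → UpperHalfPlane} (hf : Function.Injective f) :
    Set.InjOn (lift f) upperHalfPlaneSet := fun z hz w hw h => by
  have h2 : f ⟨z, hz⟩ = f ⟨w, hw⟩ := UpperHalfPlane.ext (by
    rw [← lift_coe, ← lift_coe]
    exact h)
  exact congrArg UpperHalfPlane.coe (hf h2)

namespace IsClassR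

variable {f g h : UpperHalfPlane → UpperHalfPlane}

lemma differentiableOn (hf : IsClassR f) : DifferentiableOn ℂ (lift f) upperHalfPlaneSet :=
  mdifferentiable_iff_lift.1 hf.analytic

lemma im_le (hf : IsClassR f) {z : ℂ} (hz : 0 < z.im) : z.im ≤ (lift f z).im := by
  obtain ⟨C, hC⟩ := hf.bound
  obtain ⟨hC0, hC⟩ := mem_boundConstants_iff.1 hC
  exact im_le_im_of_norm_sub_le hf.differentiableOn (fun z _ => (im_lift_pos f z).le) hC0 hC hz

lemma differentiableOn_sub (hf : IsClassR f) :
    DifferentiableOn ℂ (fun z => lift f z - z) upperHalfPlaneSet := by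
  have := hf.differentiableOn
  fun_prop

lemma im_sub_nonneg (hf : IsClassR f) (z : ℂ) (hz : 0 < z.im) : 0 ≤ (lift f z - z).im := by
  simpa using hf.im_le hz

theorem exists_isLeast_tendsto (hf : IsClassR f) :
    ∃ a : ℝ, IsLeast (boundConstants f) a ∧ Tendsto (axisFunction f) atTop (𝓝 (a : ℂ)) := by
  obtain ⟨C, hC⟩ := hf.bound
  obtain ⟨a, ha0, ha, hlim⟩ := exists_bound_and_tendsto hf.differentiableOn_sub hf.im_sub_nonneg
    (mem_boundConstants_iff.1 hC).2
  have hlim' : Tendsto (axisFunction f) atTop (𝓝 (a : ℂ)) :=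
    hlim.congr fun y => (axisFunction_eq f y).symm
  refine ⟨a, ⟨mem_boundConstants_iff.2 ⟨ha0, ha⟩, fun D hD => ?_⟩, hlim'⟩
  have h2 : Tendsto (fun y => ‖axisFunction f y‖) atTop (𝓝 a) := by
    simpa [abs_of_nonneg ha0] using hlim'.norm
  refine le_of_tendsto h2 ?_
  filter_upwards [eventually_gt_atTop 0] with y hy
  have := (mem_boundConstants_iff.1 hD).2 (Complex.I * y) (by simpa using hy)
  rw [le_div_iff₀ (by simpa using hy)] at this
  rw [axisFunction_eq, norm_neg, norm_mul, mul_comm]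
  simpa [abs_of_pos hy] using this

/-- Since `Im f(iy) ≥ y`, the value `f(iy)` is taken by `g` at some high `w` near it; injectivity of
`g` identifies `w` with `h(iy)`. -/
theorem eventually_norm_lift_sub_le (hf : IsClassR f) (hg : IsClassR g) (hfg : f = g ∘ h) :
    ∃ B : ℝ, ∀ᶠ y : ℝ in atTop, ‖lift h (Complex.I * y) - Complex.I * y‖ ≤ B := by
  obtain ⟨A, hA⟩ := hf.bound
  obtain ⟨hA0, hA⟩ := mem_boundConstants_iff.1 hA
  obtain ⟨C, hC⟩ := hg.bound
  obtain ⟨hC0, hC⟩ := mem_boundConstants_iff.1 hC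
  refine ⟨1 + A, ?_⟩
  filter_upwards [eventually_ge_atTop (C + 2)] with y hy
  have hy' : (Complex.I * (y : ℂ)).im = y := by simp
  have hy0 : 0 < (Complex.I * (y : ℂ)).im := by linarith
  have h1 := hf.im_le hy0
  obtain ⟨w, hw, hwf⟩ := exists_add_eq (ζ := lift f (Complex.I * y)) hg.differentiableOn_sub
    hg.im_sub_nonneg hC0 hC (by linarith)
  have hw0 : 0 < w.im := by linarith
  have hgw : lift g w = lift f (Complex.I * y) := by linear_combination hwf
  have hhw : lift h (Complex.I * y) = w := by
    refine injOn_lift hg.univalent (im_lift_pos h _) hw0 ?_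
    rw [hgw, hfg, lift_comp]
  rw [hhw]
  have h2 := hC w hw0
  rw [hgw] at h2
  have h3 : C / w.im ≤ 1 := (div_le_one hw0).2 (by linarith)
  have h4 := hA _ hy0
  have h5 : A / (Complex.I * (y : ℂ)).im ≤ A := div_le_self hA0 (by linarith)
  calc ‖w - Complex.I * y‖
      = ‖(lift f (Complex.I * y) - Complex.I * y) - (lift f (Complex.I * y) - w)‖ := by
        congr 1; ring
    _ ≤ ‖lift f (Complex.I * y) - Complex.I * y‖ + ‖lift f (Complex.I * y) - w‖ := norm_sub_le _ _
    _ ≤ 1 + A := by linarith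

/-- If `f = g ∘ h` with `f` and `g` in the class, then `h` is analytic. -/
theorem differentiableOn_of_eq_comp (hf : IsClassR f) (hg : IsClassR g) (hfg : f = g ∘ h) :
    DifferentiableOn ℂ (lift h) upperHalfPlaneSet := by
  have hmem : ∀ z, lift h z ∈ upperHalfPlaneSet := im_lift_pos h
  have hinj := injOn_lift hg.univalent
  have hcomp := (differentiableOn_invFunOn isOpen_upperHalfPlaneSet hg.differentiableOn hinj).comp
    hf.differentiableOn (fun z _ => ⟨lift h z, hmem z, by rw [hfg, lift_comp]⟩)
  refine hcomp.congr fun z _ => ?_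
  rw [Function.comp_apply, hfg, lift_comp]
  exact (hinj.leftInvOn_invFunOn (hmem z)).symm

/-- If `f = g ∘ h` with `f` and `g` in the class, then `h` is in the class. -/
theorem of_eq_comp (hf : IsClassR f) (hg : IsClassR g) (hfg : f = g ∘ h) : IsClassR h := by
  have hd := hf.differentiableOn_of_eq_comp hg hfg
  obtain ⟨α, -, hα, hlim⟩ := exists_angularDeriv hd fun z _ => (im_lift_pos h z).le
  obtain ⟨B, hB⟩ := hf.eventually_norm_lift_sub_le hg hfg
  have hlim1 : Tendsto (fun y : ℝ => lift h (Complex.I * y) / (Complex.I * y)) atTop (𝓝 1) := by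
    rw [tendsto_iff_norm_sub_tendsto_zero]
    refine squeeze_zero' (Eventually.of_forall fun _ => norm_nonneg _) ?_
      (tendsto_const_nhds.div_atTop tendsto_id : Tendsto (fun y : ℝ => B / y) atTop (𝓝 0))
    filter_upwards [hB, eventually_gt_atTop 0] with y hy hy0
    have hne : Complex.I * (y : ℂ) ≠ 0 := by simp [hy0.ne']
    rw [div_sub_one hne, norm_div]
    simpa [abs_of_pos hy0] using div_le_div_of_nonneg_right hy hy0.le
  have hα1 : α = 1 := by exact_mod_cast tendsto_nhds_unique hlim hlim1
  have him : ∀ z : ℂ, 0 < z.im → z.im ≤ (lift h z).im := fun z hz => by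
    simpa [hα1] using hα z hz
  refine ⟨mdifferentiable_iff_lift.2 hd, ?_, ?_⟩
  · have := hf.univalent
    rw [hfg] at this
    exact this.of_comp
  · obtain ⟨A, hA⟩ := hf.bound
    obtain ⟨hA0, hA⟩ := mem_boundConstants_iff.1 hA
    obtain ⟨C, hC⟩ := hg.bound
    obtain ⟨hC0, hC⟩ := mem_boundConstants_iff.1 hC
    refine ⟨A + C, mem_boundConstants_iff.2 ⟨by positivity, fun z hz => ?_⟩⟩
    have h1 := hA z hz
    have h2 := hC (lift h z) (im_lift_pos h z)
    rw [← lift_comp, ← hfg] at h2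
    have h3 : C / (lift h z).im ≤ C / z.im := by
      have := him z hz
      gcongr
    calc ‖lift h z - z‖ = ‖(lift f z - z) - (lift f z - lift h z)‖ := by congr 1; ring
      _ ≤ ‖lift f z - z‖ + ‖lift f z - lift h z‖ := norm_sub_le _ _
      _ ≤ (A + C) / z.im := by rw [add_div]; linarith

/-- The displacement of `g ∘ h` at `iy` is that of `h` there plus that of `g` at `h(iy)`. Moving the
latter back to `iy` costs `O(1/y)` after multiplication by `iy`. -/
theorem tendsto_axisFunction_comp (hg : IsClassR g) (hh : IsClassR h) {b c : ℂ}
    (hb : Tendsto (axisFunction g) atTop (𝓝 b)) (hc : Tendsto (axisFunction h) atTop (𝓝 c)) :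
    Tendsto (axisFunction (g ∘ h)) atTop (𝓝 (b + c)) := by
  obtain ⟨A, hA⟩ := hh.bound
  obtain ⟨hA0, hA⟩ := mem_boundConstants_iff.1 hA
  obtain ⟨C, hC⟩ := hg.bound
  obtain ⟨hC0, hC⟩ := mem_boundConstants_iff.1 hC
  have herr : Tendsto (fun y : ℝ => Complex.I * y * ((lift g (Complex.I * y) - Complex.I * y) -
      (lift g (lift h (Complex.I * y)) - lift h (Complex.I * y)))) atTop (𝓝 0) := by
    refine squeeze_zero_norm' ?_
      (tendsto_const_nhds.div_atTop tendsto_id : Tendsto (fun y : ℝ => C * A / y) atTop (𝓝 0))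
    filter_upwards [eventually_ge_atTop 1] with y hy
    have hy' : (Complex.I * (y : ℂ)).im = y := by simp
    have hy0 : 0 < y := by linarith
    have h1 := norm_sub_le_of_norm_le hg.differentiableOn_sub hg.im_sub_nonneg hC0 hC
      (z := Complex.I * y) (w := lift h (Complex.I * y)) (by rwa [hy']) (im_lift_pos h _)
    have h2 := hh.im_le (z := Complex.I * y) (by rwa [hy'])
    have h3 := hA (Complex.I * y) (by rwa [hy'])
    rw [norm_sub_rev] at h3
    rw [hy'] at h1 h2 h3
    have hIyn : ‖Complex.I * (y : ℂ)‖ = y := by simp [abs_of_pos hy0]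
    rw [norm_mul, hIyn]
    calc y * _ ≤ y * (C / (y * (lift h (Complex.I * y)).im) *
          ‖Complex.I * y - lift h (Complex.I * y)‖) := by gcongr
      _ ≤ y * (C / (y * 1) * (A / y)) := by
        have := hy.trans h2
        gcongr
      _ = C * A / y := by field_simp
  have := (hb.add hc).add herr
  rw [add_zero] at this
  refine this.congr fun y => ?_
  simp only [axisFunction_eq, lift_comp]
  ring

lemma eq_id_of_zero_mem (h0 : 0 ∈ boundConstants h) : h = id := by
  funext z
  have := h0.2 z
  rw [zero_div] at this
  exact UpperHalfPlane.ext (sub_eq_zero.1 (norm_le_zero_iff.1 this))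

theorem subordinate_iff (hf : IsClassR f) (hg : IsClassR g) :
    Subordinate f g ↔ Set.range f ⊆ Set.range g := by
  refine ⟨?_, fun hsub => ?_⟩
  · rintro ⟨h, -, rfl⟩
    exact Set.range_comp_subset_range h g
  · choose h hh using fun z => hsub (Set.mem_range_self z)
    have hfg : f = g ∘ h := funext fun z => (hh z).symm
    exact ⟨h, hf.of_eq_comp hg hfg, hfg⟩

end IsClassR

end ChordalLoewner

theorem lemmaL (f g : UpperHalfPlane → UpperHalfPlane)
    (hf : ChordalLoewner.IsClassR f) (hg : ChordalLoewner.IsClassR g) :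
    (ChordalLoewner.Subordinate f g ↔ Set.range f ⊆ Set.range g) ∧
    ∃ a b : ℝ,
      IsLeast (ChordalLoewner.boundConstants f) a ∧
      IsLeast (ChordalLoewner.boundConstants g) b ∧
      Tendsto (ChordalLoewner.axisFunction f) atTop (𝓝 (a : ℂ)) ∧
      Tendsto (ChordalLoewner.axisFunction g) atTop (𝓝 (b : ℂ)) ∧
      (ChordalLoewner.Subordinate f g → b ≤ a ∧ (a = b ↔ f = g)) := by
  obtain ⟨a, ha, hfa⟩ := hf.exists_isLeast_tendsto
  obtain ⟨b, hb, hgb⟩ := hg.exists_isLeast_tendsto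
  refine ⟨hf.subordinate_iff hg, a, b, ha, hb, hfa, hgb, ?_⟩
  rintro ⟨h, hh, rfl⟩
  obtain ⟨c, hc, hhc⟩ := hh.exists_isLeast_tendsto
  have habc : a = b + c := by
    exact_mod_cast tendsto_nhds_unique hfa (hg.tendsto_axisFunction_comp hh hgb hhc)
  refine ⟨by linarith [hc.1.1], fun hab => ?_, fun hfg => ?_⟩
  · have hc0 : c = 0 := by linarith
    rw [hc0] at hc
    rw [ChordalLoewner.IsClassR.eq_id_of_zero_mem hc.1, Function.comp_id]
  · rw [hfg] at ha
    exact ha.unique hb
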